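/- Let $n\ge 0$. An \emph{$n$-valent plabic graph} $\Gamma$ is a finite undirected graph (loops and multiple edges allowed; connectedness is not needed) embedded in a closed rectangle, the edges being polygonal arcs whose interiors lie in the open rectangle, with $n$ univalent vertices on the left side and $n$ univalent vertices on the right side of the rectangle (each labelled $1,\dots,n$ from bottom up), and with all other vertices in the interior of the rectangle and coloured black or white. Let $\bar\Gamma$ be the same graph with the opposite colours. A \emph{perfect orientation} of $\Gamma$ is an orientation of its edges for which the left vertices are sources, the right vertices are sinks, every white vertex has exactly one incoming edge, and every black vertex has exactly one outgoing edge; $\Gamma$ is \emph{perfectly orientable} if it has one. Fix a perfect orientation and non-zero complex edge weights. The \emph{boundary measurement matrix} is the $n\times n$ matrix $$A_{ij}=\sum_{\gamma\colon i\to j}(-1)^{\mathrm{wind}(\gamma)}\,\mathrm{wt}(\gamma),$$ the sum being over all directed paths (repetitions allowed) from left vertex $i$ to right vertex $j$, where $\mathrm{wt}(\gamma)$ is the product of the weights of the edges of $\gamma$ and $\mathrm{wind}(\gamma)\in\mathbb Z$ is the number of full turns made by the direction of $\gamma$ (prolonged by horizontal segments at both ends); if there are directed cycles, the sum is understood as the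 value of the rational function of the edge weights to which the formal power series adds up. A \emph{face} is a connected component of the complement of $\Gamma$ in the rectangle. Its weight is the product of $\mathrm{wt}(e)^{\pm1}$ over the edges $e$ on its boundary, with exponent $+1$ if $e$ agrees with the counterclockwise orientation of the face and $-1$ otherwise (an edge with the face on both sides contributes both factors). A \emph{face weighting} assigns non-zero complex numbers with product $1$ to the faces; the boundary measurement matrix of a face-weighted plabic graph is that of a network with these face weights. $\Gamma$ is \emph{non-degenerate} if it is perfectly orientable and, for some perfect orientation, the determinant of the boundary measurement matrix is not identically $0$ as a (partially defined) function of the face weights. \textbf{Proposition.} A plabic graph $\Gamma$ is non-degenerate if and only if both $\Gamma$ and $\bar\Gamma$ are perfectly orientable. Moreover, non-degeneracy does not depend on the perfect orientation used: for every perfect orientation of $\Gamma$, the graph $\Gamma$ is non-degenerate if and only if the determinant computed with that orientation is not identically $0$. -/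

import Mathlib

open scoped Topology

/-- The two colours of the interior vertices. -/
inductive PlabicColor
  | white
  | black

/-- The opposite colour. -/
def PlabicColor.swap : PlabicColor → PlabicColor
  | .white => .black
  | .black => .white

/-- Vertices of an `n`-valent plabic graph: `n` on the left side of the rectangle, `n` on its right
side, and the interior ones, which are indexed by `V`. -/
inductive PlabicVertex (n : ℕ) (V : Type*)
  | left (i : Fin n)
  | right (i : Fin n)
  | inner (v : V)

/-- The `k`-th point (starting with `0`) of the polygonal arc from `p` to `q` with corners `l`. -/
def polyPoint (p : ℂ) (l : List ℂ) (q : ℂ) (k : ℕ) : ℂ := (p :: (l ++ [q])).getD k 0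

/-- The `k`-th open segment, `k = 0, …, l.length`, of the polygonal arc from `p` to `q` with
corners `l`. -/
def polyOpenSegment (p : ℂ) (l : List ℂ) (q : ℂ) (k : ℕ) : Set ℂ :=
  openSegment ℝ (polyPoint p l q k) (polyPoint p l q (k + 1))

/-- An `n`-valent plabic graph with interior vertices `V` and edges `E` (loops and multiple edges are
allowed), drawn in a closed rectangle of the plane `ℂ` with edges that are polygonal arcs.

Edges are undirected; `src e` and `tgt e` are the two ends of `e` in an arbitrary reference order,
and `bends e` lists the corners of the arc `e` met from `src e` to `tgt e`.

A polygonal drawing is an embedding iff the vertices and the corners are distinct points, no open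
segment contains one of these points, and distinct open segments are disjoint. -/
structure PlabicGraph (n : ℕ) (V E : Type*) where
  /-- lower left corner of the rectangle -/
  lo : ℂ
  /-- upper right corner of the rectangle -/
  hi : ℂ
  re_lt : lo.re < hi.re
  im_lt : lo.im < hi.im
  color : V → PlabicColor
  src : E → PlabicVertex n V
  tgt : E → PlabicVertex n V
  pos : PlabicVertex n V → ℂ
  bends : E → List ℂ
  pos_left_re : ∀ i, (pos (.left i)).re = lo.re
  pos_left_im : ∀ i, (pos (.left i)).im ∈ Set.Icc lo.im hi.im
  pos_right_re : ∀ i, (pos (.right i)).re = hi.re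
  pos_right_im : ∀ i, (pos (.right i)).im ∈ Set.Icc lo.im hi.im
  /-- the left vertices are labelled from bottom up -/
  left_strictMono : StrictMono fun i => (pos (.left i)).im
  /-- the right vertices are labelled from bottom up -/
  right_strictMono : StrictMono fun i => (pos (.right i)).im
  pos_inner : ∀ v, pos (.inner v) ∈ Set.Ioo lo.re hi.re ×ℂ Set.Ioo lo.im hi.im
  bends_mem : ∀ e, ∀ z ∈ bends e, z ∈ Set.Ioo lo.re hi.re ×ℂ Set.Ioo lo.im hi.im
  /-- distinct vertices and corners are distinct points -/
  node_injective : Function.Injective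
    (Sum.elim pos fun c : (Σ e, Fin (bends e).length) => (bends c.1).get c.2)
  /-- the open segments of the arcs lie inside the rectangle -/
  segment_subset : ∀ (s : Σ e, Fin ((bends e).length + 1)),
    polyOpenSegment (pos (src s.1)) (bends s.1) (pos (tgt s.1)) s.2 ⊆
      Set.Ioo lo.re hi.re ×ℂ Set.Ioo lo.im hi.im
  /-- no vertex lies on an open segment -/
  pos_notMem : ∀ (s : Σ e, Fin ((bends e).length + 1)) (v : PlabicVertex n V),
    pos v ∉ polyOpenSegment (pos (src s.1)) (bends s.1) (pos (tgt s.1)) s.2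
  /-- no corner lies on an open segment -/
  bend_notMem : ∀ (s : Σ e, Fin ((bends e).length + 1)) (e : E), ∀ z ∈ bends e,
    z ∉ polyOpenSegment (pos (src s.1)) (bends s.1) (pos (tgt s.1)) s.2
  /-- distinct open segments are disjoint -/
  segment_disjoint : Pairwise fun s t : (Σ e, Fin ((bends e).length + 1)) =>
    Disjoint
      (polyOpenSegment (pos (src s.1)) (bends s.1) (pos (tgt s.1)) s.2)
      (polyOpenSegment (pos (src t.1)) (bends t.1) (pos (tgt t.1)) t.2)
  /-- every left vertex is the end of exactly one edge, at exactly one end of that edge -/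
  left_univalent : ∀ i, ∃! d : E × Bool, (if d.2 then src d.1 else tgt d.1) = .left i
  /-- every right vertex is the end of exactly one edge, at exactly one end of that edge -/
  right_univalent : ∀ i, ∃! d : E × Bool, (if d.2 then src d.1 else tgt d.1) = .right i

namespace PlabicGraph

variable {n : ℕ} {V E : Type*}

/-- The graph with the same drawing and the opposite colours. -/
def colorSwap (Γ : PlabicGraph n V E) : PlabicGraph n V E :=
  { Γ with color := fun v => (Γ.color v).swap }

/-! ### Orientations

An orientation is a function `O : E → Bool`; the edge `e` is directed from `src e` to `tgt e` if
`O e = true`, and from `tgt e` to `src e` otherwise. -/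

/-- The initial vertex of an edge. -/
def tail (Γ : PlabicGraph n V E) (O : E → Bool) (e : E) : PlabicVertex n V :=
  if O e then Γ.src e else Γ.tgt e

/-- The terminal vertex of an edge. -/
def head (Γ : PlabicGraph n V E) (O : E → Bool) (e : E) : PlabicVertex n V :=
  if O e then Γ.tgt e else Γ.src e

/-- Perfect orientations: the left vertices are sources, the right vertices are sinks, every white
vertex has exactly one incoming edge and every black vertex has exactly one outgoing edge. -/
structure IsPerfect (Γ : PlabicGraph n V E) (O : E → Bool) : Prop where
  left_source : ∀ e i, Γ.head O e ≠ .left i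
  right_sink : ∀ e i, Γ.tail O e ≠ .right i
  white : ∀ v, Γ.color v = .white → ∃! e, Γ.head O e = .inner v
  black : ∀ v, Γ.color v = .black → ∃! e, Γ.tail O e = .inner v

/-- A plabic graph is perfectly orientable if it has a perfect orientation. -/
def PerfectlyOrientable (Γ : PlabicGraph n V E) : Prop :=
  ∃ O : E → Bool, Γ.IsPerfect O

/-! ### Directed paths and their winding index -/

/-- `Γ.IsPath O u v γ`: the list of edges `γ` is a directed path from `u` to `v`; vertices and edges
may be repeated. -/
def IsPath (Γ : PlabicGraph n V E) (O : E → Bool) :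
    PlabicVertex n V → PlabicVertex n V → List E → Prop
  | u, v, [] => u = v
  | u, v, e :: γ => Γ.tail O e = u ∧ Γ.IsPath O (Γ.head O e) v γ

/-- The points met along the directed edge `e` after its initial vertex: the corners, in order, and
the terminal vertex. -/
def edgePoints (Γ : PlabicGraph n V E) (O : E → Bool) (e : E) : List ℂ :=
  (if O e then Γ.bends e else (Γ.bends e).reverse) ++ [Γ.pos (Γ.head O e)]

/-- The total (counterclockwise) turning angle of the polygonal line through the listed points: at
each corner the direction turns by an angle between `-π` and `π`. -/
noncomputable def turning : List ℂ → ℝ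
  | a :: b :: c :: l => Complex.arg ((c - b) / (b - a)) + turning (b :: c :: l)
  | _ => 0

/-- The polygonal line traced by a path `γ` from left vertex `i` to right vertex `j`, prolonged by
horizontal segments at both ends so that it starts and ends in the horizontal direction. -/
def pathPoints (Γ : PlabicGraph n V E) (O : E → Bool) (i j : Fin n) (γ : List E) : List ℂ :=
  (Γ.pos (.left i) - 1) :: Γ.pos (.left i) :: (γ.flatMap (Γ.edgePoints O) ++
    [Γ.pos (.right j) + 1])

/-- The winding index of a path from left vertex `i` to right vertex `j`: the number of full turns
made by its direction. The quotient being rounded is already an integer, see `two_pi_mul_wind`. -/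
noncomputable def wind (Γ : PlabicGraph n V E) (O : E → Bool) (i j : Fin n) (γ : List E) : ℤ :=
  round (turning (Γ.pathPoints O i j γ) / (2 * Real.pi))

/-- Two consecutive points of an edge are distinct. -/
theorem isChain_edge (Γ : PlabicGraph n V E) (e : E) :
    (Γ.pos (Γ.src e) :: (Γ.bends e ++ [Γ.pos (Γ.tgt e)])).IsChain (· ≠ ·) := by
  rw [List.isChain_iff_getElem]
  intro k hk heq
  have hk' : k < (Γ.bends e).length + 1 := by simpa using hk
  have hs : polyOpenSegment (Γ.pos (Γ.src e)) (Γ.bends e) (Γ.pos (Γ.tgt e)) k =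
      {(Γ.pos (Γ.src e) :: (Γ.bends e ++ [Γ.pos (Γ.tgt e)]))[k]} := by
    unfold polyOpenSegment polyPoint
    rw [List.getD_eq_getElem _ _ hk, List.getD_eq_getElem _ _ (Nat.lt_of_succ_lt hk), ← heq,
      openSegment_same]
  have hmem : (Γ.pos (Γ.src e) :: (Γ.bends e ++ [Γ.pos (Γ.tgt e)]))[k] ∈
      Γ.pos (Γ.src e) :: (Γ.bends e ++ [Γ.pos (Γ.tgt e)]) := List.getElem_mem _
  have h1 := fun v => Γ.pos_notMem ⟨e, ⟨k, hk'⟩⟩ v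
  have h2 := fun z hz => Γ.bend_notMem ⟨e, ⟨k, hk'⟩⟩ e z hz
  simp only [hs, Set.mem_singleton_iff] at h1 h2
  rw [List.mem_cons, List.mem_append, List.mem_singleton] at hmem
  rcases hmem with h | h | h
  · exact h1 _ h.symm
  · exact h2 _ h rfl
  · exact h1 _ h.symm

theorem isChain_edgePoints (Γ : PlabicGraph n V E) (O : E → Bool) (e : E) :
    (Γ.pos (Γ.tail O e) :: Γ.edgePoints O e).IsChain (· ≠ ·) := by
  have h := Γ.isChain_edge e
  cases hO : O e
  · have h' := List.isChain_reverse.2 (h.imp fun _ _ hab => Ne.symm hab)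
    simpa [edgePoints, tail, head, hO] using h'
  · simpa [edgePoints, tail, head, hO] using h

theorem getLast?_edgePoints (Γ : PlabicGraph n V E) (O : E → Bool) (e : E) :
    (Γ.edgePoints O e).getLast? = some (Γ.pos (Γ.head O e)) := by
  simp [edgePoints]

theorem IsPath.polyline {Γ : PlabicGraph n V E} {O : E → Bool} {v : PlabicVertex n V} :
    ∀ {γ : List E} {u : PlabicVertex n V}, Γ.IsPath O u v γ →
      (Γ.pos u :: γ.flatMap (Γ.edgePoints O)).IsChain (· ≠ ·) ∧
      (Γ.pos u :: γ.flatMap (Γ.edgePoints O)).getLast? = some (Γ.pos v)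
  | [], u, h => by
    cases h
    simp
  | e :: γ, u, h => by
    obtain ⟨rfl, h⟩ := h
    obtain ⟨hc, hl⟩ := IsPath.polyline h
    have he := Γ.isChain_edgePoints O e
    have hsplit : Γ.edgePoints O e ++ γ.flatMap (Γ.edgePoints O) =
        (if O e then Γ.bends e else (Γ.bends e).reverse) ++
          (Γ.pos (Γ.head O e) :: γ.flatMap (Γ.edgePoints O)) := by
      simp [edgePoints]
    refine ⟨?_, ?_⟩
    · rw [List.flatMap_cons, ← List.cons_append, List.isChain_append]
      refine ⟨he, hc.tail, ?_⟩
      intro x hx y hy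
      have hx' : x = Γ.pos (Γ.head O e) := by
        rw [Option.mem_def, List.getLast?_cons, getLast?_edgePoints] at hx
        exact (Option.some.inj hx).symm
      subst hx'
      cases hf : γ.flatMap (Γ.edgePoints O) with
      | nil => simp [hf] at hy
      | cons z l =>
        rw [hf] at hc hy
        have : y = z := by simpa [eq_comm] using hy
        subst this
        exact (List.isChain_cons_cons.1 hc).1
    · rw [List.flatMap_cons, hsplit, ← List.cons_append, List.getLast?_append, hl]
      rfl

theorem exp_turning (a b c : ℂ) (l : List ℂ) (h : (a :: b :: l).IsChain (· ≠ ·))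
    (hl : (b :: l).getLast? = some c) :
    Complex.exp (turning (a :: b :: (l ++ [c + 1])) * Complex.I) * ((b - a) / ‖b - a‖) = 1 := by
  have key : ∀ z w : ℂ, z ≠ 0 → w ≠ 0 →
      Complex.exp (Complex.arg (z / w) * Complex.I) * (w / ‖w‖) = z / ‖z‖ := by
    intro z w hz hw
    have hzn : (‖z‖ : ℂ) ≠ 0 := by exact_mod_cast norm_ne_zero_iff.2 hz
    have hwn : (‖w‖ : ℂ) ≠ 0 := by exact_mod_cast norm_ne_zero_iff.2 hw
    have h := Complex.norm_mul_exp_arg_mul_I (z / w)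
    rw [norm_div, Complex.ofReal_div] at h
    have h2 : Complex.exp (Complex.arg (z / w) * Complex.I) = z / w * (‖w‖ / ‖z‖) := by
      generalize Complex.exp (Complex.arg (z / w) * Complex.I) = x at h ⊢
      rw [← h]
      field_simp
    rw [h2]
    field_simp
  induction l generalizing a b with
  | nil =>
    obtain rfl : b = c := by simpa using hl
    have hab : b - a ≠ 0 := sub_ne_zero.2 (by simpa [eq_comm] using h)
    have := key 1 (b - a) one_ne_zero hab
    simpa [turning] using this
  | cons d l ih =>
    obtain ⟨hab, h'⟩ := List.isChain_cons_cons.1 h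
    have hbd := (List.isChain_cons_cons.1 h').1
    have h1 := ih b d h' (by simpa using hl)
    have h2 := key (d - b) (b - a) (sub_ne_zero.2 hbd.symm) (sub_ne_zero.2 hab.symm)
    rw [← h2] at h1
    rw [List.cons_append, turning, Complex.ofReal_add, add_mul, Complex.exp_add,
      mul_comm (Complex.exp _), mul_assoc]
    exact h1

/-- The total turning angle of a path is `2π` times its winding index, which is an integer. -/
theorem two_pi_mul_wind (Γ : PlabicGraph n V E) (O : E → Bool) (i j : Fin n) (γ : List E)
    (h : Γ.IsPath O (.left i) (.right j) γ) :
    2 * Real.pi * Γ.wind O i j γ = turning (Γ.pathPoints O i j γ) := by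
  obtain ⟨hc, hl⟩ := h.polyline
  have h1 := exp_turning (Γ.pos (.left i) - 1) (Γ.pos (.left i)) (Γ.pos (.right j)) _
    (List.isChain_cons_cons.2 ⟨by simp, hc⟩) hl
  have h2 : Complex.exp (turning (Γ.pathPoints O i j γ) * Complex.I) = 1 := by
    simpa [pathPoints] using h1
  obtain ⟨k, hk⟩ := Complex.exp_eq_one_iff.1 h2
  have h3 : turning (Γ.pathPoints O i j γ) = k * (2 * Real.pi) := by
    have : (turning (Γ.pathPoints O i j γ) : ℂ) = ((k * (2 * Real.pi) : ℝ) : ℂ) := by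
      apply mul_right_cancel₀ Complex.I_ne_zero
      rw [hk]
      push_cast
      ring
    exact_mod_cast this
  have hpi : (2 * Real.pi) ≠ 0 := by positivity
  rw [wind, h3, mul_div_cancel_right₀ _ hpi, round_intCast]
  ring

/-! ### The boundary measurement matrix -/

/-- The formal sum `∑ (-1) ^ wind γ * wt γ` over all directed paths `γ` from `i` to `j`, a power
series in the edge weights: its coefficient at a monomial is the sum of the signs `(-1) ^ wind γ` over
the (finitely many) paths whose weight is that monomial. -/
noncomputable def pathSeries (Γ : PlabicGraph n V E) (O : E → Bool) (i j : Fin n) :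
    MvPowerSeries E ℂ := fun m =>
  ∑ᶠ γ ∈ {γ : List E | Γ.IsPath O (.left i) (.right j) γ ∧
    (γ.map fun e => Finsupp.single e 1).sum = m}, (-1 : ℂ) ^ Γ.wind O i j γ

/-- The power series `f` adds up to a rational function which is regular at `w` and takes the value
`a` there. -/
def IsRationalValue (f : MvPowerSeries E ℂ) (w : E → ℂ) (a : ℂ) : Prop :=
  ∃ P Q : MvPolynomial E ℂ, (Q : MvPowerSeries E ℂ) * f = (P : MvPowerSeries E ℂ) ∧
    MvPolynomial.eval w Q ≠ 0 ∧ a = MvPolynomial.eval w P / MvPolynomial.eval w Q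

/-- The value of a power series that adds up to a rational function is unique. -/
theorem IsRationalValue.unique {f : MvPowerSeries E ℂ} {w : E → ℂ} {a b : ℂ}
    (ha : IsRationalValue f w a) (hb : IsRationalValue f w b) : a = b := by
  obtain ⟨P, Q, h, hQ, rfl⟩ := ha
  obtain ⟨P', Q', h', hQ', rfl⟩ := hb
  have hPQ : P * Q' = P' * Q := by
    apply MvPolynomial.coe_injective (σ := E) (R := ℂ)
    rw [MvPolynomial.coe_mul, MvPolynomial.coe_mul, ← h, ← h']
    ring
  rw [div_eq_div_iff hQ hQ', ← map_mul, ← map_mul, hPQ]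

/-- `A` is the boundary measurement matrix of the network given by the orientation `O` and the edge
weights `w`. -/
def IsBoundaryMeasurement (Γ : PlabicGraph n V E) (O : E → Bool) (w : E → ℂˣ)
    (A : Matrix (Fin n) (Fin n) ℂ) : Prop :=
  ∀ i j, IsRationalValue (Γ.pathSeries O i j) (fun e => (w e : ℂ)) (A i j)

/-! ### Faces and face weights -/

/-- The union of all edges and vertices. -/
def image (Γ : PlabicGraph n V E) : Set ℂ :=
  Set.range Γ.pos ∪ ⋃ s : (Σ e, Fin ((Γ.bends e).length + 1)),
    segment ℝ (polyPoint (Γ.pos (Γ.src s.1)) (Γ.bends s.1) (Γ.pos (Γ.tgt s.1)) s.2)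
      (polyPoint (Γ.pos (Γ.src s.1)) (Γ.bends s.1) (Γ.pos (Γ.tgt s.1)) (s.2 + 1))

/-- The complement of the graph in the closed rectangle. -/
def compl (Γ : PlabicGraph n V E) : Set ℂ :=
  (Set.Icc Γ.lo.re Γ.hi.re ×ℂ Set.Icc Γ.lo.im Γ.hi.im) \ Γ.image

/-- The faces: the connected components of the complement. -/
abbrev Face (Γ : PlabicGraph n V E) : Type := ConnectedComponents Γ.compl

/-- `F` is adjacent to `e` on the left-hand side of the directed edge `e`: the points that are close to
the midpoint `m` of a segment of the arc, on the normal pointing to the left, belong to `F`. (The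
side of an arc lies in one face, so the choice of `m` is irrelevant; it is taken on the segment which
contains `src e`.) -/
def IsLeftFace (Γ : PlabicGraph n V E) (O : E → Bool) (F : Γ.Face) (e : E) : Prop :=
  let p : ℂ := Γ.pos (Γ.src e)
  let q : ℂ := polyPoint (Γ.pos (Γ.src e)) (Γ.bends e) (Γ.pos (Γ.tgt e)) 1
  let u : ℂ := if O e then q - p else p - q
  ∀ᶠ t : ℝ in 𝓝[>] 0, ∃ h : (p + q) / 2 + t * (Complex.I * u) ∈ Γ.compl,
    ConnectedComponents.mk (⟨_, h⟩ : Γ.compl) = F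

open Classical in
/-- The exponent of the weight of `e` in the weight of `F`: the edge is counted with sign `+` if its
direction agrees with the counterclockwise orientation of the boundary of `F` (`F` is on the left of
`e`), with sign `-` if it does not (`F` is on the right of `e`), and with both signs if `F` is on both
sides. -/
noncomputable def faceExponent (Γ : PlabicGraph n V E) (O : E → Bool) (F : Γ.Face) (e : E) : ℤ :=
  (if Γ.IsLeftFace O F e then 1 else 0) - (if Γ.IsLeftFace (fun e => !O e) F e then 1 else 0)

/-- The weight of the face `F` of the network given by the orientation `O` and edge weights `w`. -/
noncomputable def faceWeight [Fintype E] (Γ : PlabicGraph n V E) (O : E → Bool) (w : E → ℂˣ)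
    (F : Γ.Face) : ℂˣ :=
  ∏ e, w e ^ Γ.faceExponent O F e

/-- The space of face weightings: non-zero numbers on the faces with product `1`. -/
def FaceWeighting (Γ : PlabicGraph n V E) : Type :=
  {Y : Γ.Face → ℂˣ // ∏ᶠ F, Y F = 1}

/-- `A` is the boundary measurement matrix of the face-weighted graph `(Γ, Y)`, computed with the
orientation `O`: it is the boundary measurement matrix of a network with face weights `Y`. -/
def IsMeas [Fintype E] (Γ : PlabicGraph n V E) (O : E → Bool) (Y : Γ.FaceWeighting)
    (A : Matrix (Fin n) (Fin n) ℂ) : Prop :=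
  ∃ w : E → ℂˣ, Γ.faceWeight O w = Y.1 ∧ Γ.IsBoundaryMeasurement O w A

/-- The determinant of the boundary measurement matrix, computed with the orientation `O`, is
identically zero as a (partially defined) function of the face weights. -/
def DetVanishes [Fintype E] (Γ : PlabicGraph n V E) (O : E → Bool) : Prop :=
  ∀ (Y : Γ.FaceWeighting) (A : Matrix (Fin n) (Fin n) ℂ), Γ.IsMeas O Y A → A.det = 0

/-- A plabic graph is non-degenerate if it is perfectly orientable and the determinant of its boundary
measurement matrix, computed with a perfect orientation, is not identically zero. -/
def NonDegenerate [Fintype E] (Γ : PlabicGraph n V E) : Prop :=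
  ∃ O : E → Bool, Γ.IsPerfect O ∧ ¬ Γ.DetVanishes O

end PlabicGraph

/-! The sign `(-1) ^ wind` is `exp (i θ / 2)` for the total turning angle `θ`, and turning is
additive along a path, so the sign is a product of phases of single steps. Hence path counting is a
transfer-matrix computation: the matrix of path series is `R (1 - K)⁻¹ C`, where `K`, `R`, `C`
record the phases of steps, starts and ends. By a Schur complement its determinant is, up to the
unit `det (1 - K)`, the determinant of one block matrix (`det_block_X`). The only property of the
phases used after this is that they are non-zero exactly at admissible transitions.

If the boundary determinant is non-zero somewhere, some Leibniz term of the block determinant is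
non-zero. Its permutation is a flow: disjoint paths using all left and right vertices, together with
disjoint cycles (`exists_isFlow_of_det_block_ne_zero`). Keeping the flow edges and reversing all
others turns a perfect orientation of the graph into one of the colour-swapped graph
(`IsFlow.perfectlyOrientable_colorSwap`).

Conversely, let `O` and `O'` be perfect orientations of the graph and of its colour swap. The edges
on which they agree form a flow. Letting their weights tend to infinity, with weight zero on the
others, isolates this flow: the rescaled matrix has an invertible limit (`det_flowMatrix_ne_zero`).
So the block determinant is a non-zero polynomial, and generic non-zero weights give a non-zero
boundary determinant. This works for every perfect orientation `O`, which also gives the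
independence statement. The drawing enters once more in `finprod_faceWeight`, which shows that edge
weights induce genuine face weightings. -/

/-! ### Power series indexed by words -/

/-- The formal sum over all words `γ` in the letters `E` of `g γ` times the product of the letters,
regarded as commuting variables. -/
noncomputable def listSeries {E : Type*} (g : List E → ℂ) : MvPowerSeries E ℂ := fun m =>
  ∑ᶠ γ ∈ {γ : List E | (γ.map fun e => Finsupp.single e 1).sum = m}, g γ

theorem coeff_listSeries {E : Type*} (g : List E → ℂ) (m : E →₀ ℕ) :
    MvPowerSeries.coeff m (listSeries g) =
      ∑ᶠ γ ∈ {γ : List E | (γ.map fun e => Finsupp.single e 1).sum = m}, g γ := rfl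

theorem degree_sum_map_single {E : Type*} (γ : List E) :
    ((γ.map fun e => Finsupp.single e 1).sum : E →₀ ℕ).degree = γ.length := by
  induction γ with
  | nil => simp
  | cons e γ ih => simp [ih, add_comm]

/-- The degree of `m` fixes the length of the word. Finiteness keeps the `finsum` in `listSeries`
from taking its default value `0`. -/
theorem finite_setOf_sum_map_single_eq {E : Type*} [Finite E] (m : E →₀ ℕ) :
    {γ : List E | (γ.map fun e => Finsupp.single e 1).sum = m}.Finite := by
  refine (List.finite_length_eq E m.degree).subset ?_
  rintro γ rfl
  exact (degree_sum_map_single γ).symm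

theorem listSeries_const_mul {E : Type*} [Finite E] (a : ℂ) (g : List E → ℂ) :
    listSeries (fun γ => a * g γ) = MvPowerSeries.C a * listSeries g := by
  ext m
  rw [MvPowerSeries.coeff_C_mul, coeff_listSeries, coeff_listSeries,
    mul_finsum_mem' _ _ (finite_setOf_sum_map_single_eq m)]

/-- Splitting words by their first letter; this is the source of the linear recursion for path
series. -/
theorem listSeries_eq {E : Type*} [Fintype E] (g : List E → ℂ) :
    listSeries g = MvPowerSeries.C (g []) +
      ∑ f, MvPowerSeries.X f * listSeries (fun γ => g (f :: γ)) := by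
  classical
  ext m
  have hset : {γ : List E | (γ.map fun e => Finsupp.single e 1).sum = m} =
      {γ : List E | γ = [] ∧ m = 0} ∪ ⋃ f : E, (List.cons f) ''
        {γ : List E | Finsupp.single f 1 + (γ.map fun e => Finsupp.single e 1).sum = m} := by
    ext γ
    cases γ <;> simp [eq_comm]
  have hfin := finite_setOf_sum_map_single_eq m
  rw [hset, Set.finite_union] at hfin
  obtain ⟨h1, h2⟩ := hfin
  have h3 := fun f => (h2.subset (Set.subset_iUnion (fun f : E => (List.cons f) ''
        {γ : List E | Finsupp.single f 1 + (γ.map fun e => Finsupp.single e 1).sum = m}) f))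
  rw [coeff_listSeries, hset, finsum_mem_union _ h1 h2, finsum_mem_iUnion _ h3,
    finsum_eq_sum_of_fintype (α := E), map_add, map_sum]
  · congr 1
    · rw [MvPowerSeries.coeff_C]
      by_cases hm : m = 0
      · have : {γ : List E | γ = [] ∧ m = 0} = {[]} := by ext; simp [hm]
        rw [this, finsum_mem_singleton, if_pos hm]
      · simp [hm]
    · refine Finset.sum_congr rfl fun f _ => ?_
      rw [finsum_mem_image (by simp), MvPowerSeries.X, MvPowerSeries.coeff_monomial_mul]
      split_ifs with hf
      · have : {γ : List E | Finsupp.single f 1 + (γ.map fun e => Finsupp.single e 1).sum = m} =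
            {γ : List E | (γ.map fun e => Finsupp.single e 1).sum = m - Finsupp.single f 1} := by
          ext γ
          change _ = _ ↔ _ = _
          rw [eq_tsub_iff_add_eq_of_le hf, add_comm]
        rw [one_mul, coeff_listSeries, this]
      · have : {γ : List E | Finsupp.single f 1 +
            (γ.map fun e => Finsupp.single e 1).sum = m} = ∅ := by
          rw [Set.eq_empty_iff_forall_notMem]
          rintro γ rfl
          exact hf le_self_add
        rw [this, finsum_mem_empty]
  · intro f g hfg
    rw [Function.onFun, Set.disjoint_left]
    rintro _ ⟨γ, -, rfl⟩ ⟨γ', -, h⟩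
    exact hfg (List.cons.inj h).1.symm
  · rw [Set.disjoint_left]
    rintro _ ⟨rfl, -⟩ h
    simp at h

/-! ### Transfer matrices -/

namespace TransferMatrix

variable {E ι S : Type*} [CommRing S] [Algebra ℂ S]

/-- The matrix with entries `k a e * x e`. -/
def weighted {κ : Type*} (k : κ → E → ℂ) (x : E → S) : Matrix κ E S :=
  Matrix.of fun a e => algebraMap ℂ S (k a e) * x e

theorem map_weighted {κ T : Type*} [CommRing T] [Algebra ℂ T] (k : κ → E → ℂ) (x : E → S)
    (φ : S →ₐ[ℂ] T) : (weighted k x).map φ = weighted k (φ ∘ x) := by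
  ext
  simp [weighted]

variable [DecidableEq E]

/-- The matrix whose determinant is the numerator of the determinant of `R (1 - K)⁻¹ C`, see
`det_block`. -/
def block (k : E → E → ℂ) (r : ι → E → ℂ) (c : E → ι → ℂ) (x : E → S) :
    Matrix (E ⊕ ι) (E ⊕ ι) S :=
  Matrix.fromBlocks (1 - weighted k x) (Matrix.of fun e j => algebraMap ℂ S (c e j))
    (-weighted r x) 0

theorem map_one_sub_weighted {T : Type*} [CommRing T] [Algebra ℂ T] (k : E → E → ℂ) (x : E → S)
    (φ : S →ₐ[ℂ] T) : (1 - weighted k x).map φ = 1 - weighted k (φ ∘ x) := by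
  rw [← map_weighted, Matrix.map_sub _ (map_sub φ), Matrix.map_one _ (map_zero φ) (map_one φ)]

theorem map_block {T : Type*} [CommRing T] [Algebra ℂ T] (k : E → E → ℂ) (r : ι → E → ℂ)
    (c : E → ι → ℂ) (x : E → S) (φ : S →ₐ[ℂ] T) :
    (block k r c x).map φ = block k r c (φ ∘ x) := by
  rw [block, Matrix.fromBlocks_map, map_one_sub_weighted, block]
  congr 1
  · ext; simp
  · ext; simp [weighted]
  · ext; simp

variable [Fintype E] [Fintype ι] [DecidableEq ι]

/-- Schur complement of the upper left block. The minus sign in the lower left block of `block`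
cancels the one in the complement. -/
theorem det_block (k : E → E → ℂ) (r : ι → E → ℂ) (c : E → ι → ℂ) (x : E → S)
    (h : IsUnit (1 - weighted k x).det) :
    (block k r c x).det = (1 - weighted k x).det *
      (weighted r x * ((1 - weighted k x)⁻¹ * Matrix.of fun e j => algebraMap ℂ S (c e j))).det := by
  let _ := Matrix.invertibleOfIsUnitDet _ h
  rw [block, Matrix.det_fromBlocks₁₁, Matrix.invOf_eq_nonsing_inv]
  simp [Matrix.mul_assoc]

end TransferMatrix

/-! ### Turning angles -/

namespace PlabicGraph

/-- Turning is a sum over triples of consecutive points, so pieces that overlap in one segment, two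
points, share no triple and miss none. -/
theorem turning_append (l : List ℂ) (a b : ℂ) (l' : List ℂ) :
    turning (l ++ a :: b :: l') = turning (l ++ [a, b]) + turning (a :: b :: l') := by
  induction l with
  | nil => simp [turning]
  | cons x l ih =>
    cases l with
    | nil => simp [turning]
    | cons y l =>
      cases l with
      | nil =>
        simp only [List.cons_append, List.nil_append] at ih ⊢
        rw [turning, ih]
        simp only [turning]
        ring
      | cons z l =>
        simp only [List.cons_append] at ih ⊢
        rw [turning, ih, turning, add_assoc]

variable {n : ℕ} {V E : Type*}

/-- The last point of the directed edge `e` before its terminal vertex. -/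
def penultimate (Γ : PlabicGraph n V E) (O : E → Bool) (e : E) : ℂ :=
  (Γ.pos (Γ.tail O e) :: if O e then Γ.bends e else (Γ.bends e).reverse).getLast (by simp)

theorem turning_edgePoints_append (Γ : PlabicGraph n V E) (O : E → Bool) (e : E) (a : ℂ)
    (l : List ℂ) :
    turning (a :: Γ.pos (Γ.tail O e) :: (Γ.edgePoints O e ++ l)) =
      turning (a :: Γ.pos (Γ.tail O e) :: Γ.edgePoints O e) +
        turning (Γ.penultimate O e :: Γ.pos (Γ.head O e) :: l) := by
  have h : ∀ l, a :: Γ.pos (Γ.tail O e) :: (Γ.edgePoints O e ++ l) =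
      (a :: (Γ.pos (Γ.tail O e) :: if O e then Γ.bends e else (Γ.bends e).reverse).dropLast) ++
        Γ.penultimate O e :: Γ.pos (Γ.head O e) :: l := by
    intro l
    have := List.dropLast_append_getLast
      (l := Γ.pos (Γ.tail O e) :: if O e then Γ.bends e else (Γ.bends e).reverse) (by simp)
    rw [List.cons_append, ← List.singleton_append (x := Γ.penultimate O e), ← List.append_assoc,
      penultimate, this, edgePoints]
    simp
  have h' := h []
  rw [List.append_nil] at h'
  rw [h, turning_append, h']

/-! ### Half-angle phases and the factorization of path signs -/

/-- The sign factor `exp (i θ / 2)` of the turning angle `θ` of a polygonal line. -/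
noncomputable def turnPhase (l : List ℂ) : ℂ := Complex.exp (turning l / 2 * Complex.I)

theorem turnPhase_ne_zero (l : List ℂ) : turnPhase l ≠ 0 := Complex.exp_ne_zero _

theorem turnPhase_edgePoints_append (Γ : PlabicGraph n V E) (O : E → Bool) (e : E) (a : ℂ)
    (l : List ℂ) :
    turnPhase (a :: Γ.pos (Γ.tail O e) :: (Γ.edgePoints O e ++ l)) =
      turnPhase (a :: Γ.pos (Γ.tail O e) :: Γ.edgePoints O e) *
        turnPhase (Γ.penultimate O e :: Γ.pos (Γ.head O e) :: l) := by
  rw [turnPhase, turnPhase, turnPhase, ← Complex.exp_add, turning_edgePoints_append]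
  push_cast
  ring_nf

/-- Half of the total angle `2π * wind` is `π * wind`. Unlike the integer winding index, the phase
also makes sense for pieces of a path. -/
theorem neg_one_zpow_wind (Γ : PlabicGraph n V E) (O : E → Bool) (i j : Fin n) (γ : List E)
    (h : Γ.IsPath O (.left i) (.right j) γ) :
    (-1 : ℂ) ^ Γ.wind O i j γ = turnPhase (Γ.pathPoints O i j γ) := by
  rw [turnPhase, ← Γ.two_pi_mul_wind O i j γ h, ← Complex.exp_pi_mul_I, ← Complex.exp_int_mul]
  congr 1
  push_cast
  ring

open Classical in
/-- The phase of the transition from the edge `e` to the edge `f`. -/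
noncomputable def stepPhase (Γ : PlabicGraph n V E) (O : E → Bool) (e f : E) : ℂ :=
  if Γ.head O e = Γ.tail O f then
    turnPhase (Γ.penultimate O e :: Γ.pos (Γ.tail O f) :: Γ.edgePoints O f) else 0

open Classical in
/-- The phase of the beginning of a path from `i` with first edge `f`. -/
noncomputable def startPhase (Γ : PlabicGraph n V E) (O : E → Bool) (i : Fin n) (f : E) : ℂ :=
  if Γ.tail O f = .left i then
    turnPhase ((Γ.pos (.left i) - 1) :: Γ.pos (Γ.tail O f) :: Γ.edgePoints O f) else 0

open Classical in
/-- The phase of the end of a path to `j` with last edge `e`. -/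
noncomputable def endPhase (Γ : PlabicGraph n V E) (O : E → Bool) (e : E) (j : Fin n) : ℂ :=
  if Γ.head O e = .right j then
    turnPhase [Γ.penultimate O e, Γ.pos (Γ.head O e), Γ.pos (.right j) + 1] else 0

theorem stepPhase_ne_zero_iff {Γ : PlabicGraph n V E} {O : E → Bool} {e f : E} :
    Γ.stepPhase O e f ≠ 0 ↔ Γ.head O e = Γ.tail O f := by
  simp [stepPhase, turnPhase_ne_zero]

theorem startPhase_ne_zero_iff {Γ : PlabicGraph n V E} {O : E → Bool} {i : Fin n} {f : E} :
    Γ.startPhase O i f ≠ 0 ↔ Γ.tail O f = .left i := by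
  simp [startPhase, turnPhase_ne_zero]

theorem endPhase_ne_zero_iff {Γ : PlabicGraph n V E} {O : E → Bool} {e : E} {j : Fin n} :
    Γ.endPhase O e j ≠ 0 ↔ Γ.head O e = .right j := by
  simp [endPhase, turnPhase_ne_zero]

open Classical in
/-- The phase of the part after `e` of a path to `j` that continues after `e` with `γ`. -/
noncomputable def restPhase (Γ : PlabicGraph n V E) (O : E → Bool) (j : Fin n) (e : E)
    (γ : List E) : ℂ :=
  if Γ.IsPath O (Γ.head O e) (.right j) γ then
    turnPhase (Γ.penultimate O e :: Γ.pos (Γ.head O e) :: (γ.flatMap (Γ.edgePoints O) ++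
      [Γ.pos (.right j) + 1])) else 0

theorem restPhase_nil (Γ : PlabicGraph n V E) (O : E → Bool) (j : Fin n) (e : E) :
    Γ.restPhase O j e [] = Γ.endPhase O e j := by
  by_cases h : Γ.head O e = .right j <;> simp [restPhase, endPhase, IsPath, h]

/-- The step from `e` to `f` is charged with the corner at the common vertex and all corners inside
`f`; the corner at the head of `f` is left to the next factor. -/
theorem restPhase_cons (Γ : PlabicGraph n V E) (O : E → Bool) (j : Fin n) (e f : E) (γ : List E) :
    Γ.restPhase O j e (f :: γ) = Γ.stepPhase O e f * Γ.restPhase O j f γ := by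
  by_cases h : Γ.tail O f = Γ.head O e
  · by_cases h' : Γ.IsPath O (Γ.head O f) (.right j) γ
    · simp only [restPhase, stepPhase, IsPath, h, h', and_self, if_true, List.flatMap_cons,
        List.append_assoc]
      rw [← h, turnPhase_edgePoints_append]
    · simp [restPhase, stepPhase, IsPath, h']
  · simp [restPhase, stepPhase, IsPath, h, Ne.symm h]

/-! ### Linear recursion for the path series -/

/-- The sum over all paths from `i` to `j` in terms of its parts after the first edge. -/
theorem pathSeries_eq_sum [Fintype E] (Γ : PlabicGraph n V E) (O : E → Bool) (i j : Fin n) :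
    Γ.pathSeries O i j = ∑ f, (MvPowerSeries.C (Γ.startPhase O i f) * MvPowerSeries.X f) *
      listSeries (Γ.restPhase O j f) := by
  classical
  have h : Γ.pathSeries O i j = listSeries fun γ =>
      if Γ.IsPath O (.left i) (.right j) γ then (-1 : ℂ) ^ Γ.wind O i j γ else 0 := by
    funext m
    rw [pathSeries, listSeries, finsum_mem_def, finsum_mem_def]
    refine finsum_congr fun γ => ?_
    by_cases h1 : Γ.IsPath O (.left i) (.right j) γ <;>
      simp [Set.indicator, h1]
  -- There is no constant term: the empty path cannot join a left vertex to a right one.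
  rw [h, listSeries_eq, if_neg (by simp [IsPath]), map_zero, zero_add]
  refine Finset.sum_congr rfl fun f _ => ?_
  rw [mul_comm (MvPowerSeries.C _), mul_assoc, ← listSeries_const_mul]
  congr 2
  funext γ
  split_ifs with hp
  · obtain ⟨h1, h2⟩ := id hp
    rw [neg_one_zpow_wind _ _ _ _ _ hp, startPhase, if_pos h1, restPhase, if_pos h2, pathPoints,
      List.flatMap_cons, List.append_assoc, ← turnPhase_edgePoints_append, h1]
  · simp only [startPhase, restPhase]
    split_ifs with h1 h2 
    · exact absurd ⟨h1, h2⟩ hp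
    all_goals simp

theorem listSeries_restPhase [Fintype E] (Γ : PlabicGraph n V E) (O : E → Bool) (j : Fin n)
    (e : E) : listSeries (Γ.restPhase O j e) = MvPowerSeries.C (Γ.endPhase O e j) +
      ∑ f, (MvPowerSeries.C (Γ.stepPhase O e f) * MvPowerSeries.X f) *
        listSeries (Γ.restPhase O j f) := by
  rw [listSeries_eq, restPhase_nil]
  congr 1
  refine Finset.sum_congr rfl fun f _ => ?_
  rw [mul_comm (MvPowerSeries.C _), mul_assoc, ← listSeries_const_mul]
  simp only [restPhase_cons]

end PlabicGraph

namespace PlabicGraph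

variable {n : ℕ} {V E : Type*}

/-! ### Existence of a perfect orientation of the graph with the opposite colours -/

theorem eq_of_tail_eq_left {Γ : PlabicGraph n V E} {O : E → Bool} {e f : E} {i : Fin n}
    (he : Γ.tail O e = .left i) (hf : Γ.tail O f = .left i) : e = f := by
  have h := (Γ.left_univalent i).unique (y₁ := (e, O e)) (y₂ := (f, O f)) he hf
  exact congrArg Prod.fst h

theorem eq_of_head_eq_right {Γ : PlabicGraph n V E} {O : E → Bool} {e f : E} {j : Fin n}
    (he : Γ.head O e = .right j) (hf : Γ.head O f = .right j) : e = f := by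
  have h := (Γ.right_univalent j).unique (y₁ := (e, !O e)) (y₂ := (f, !O f))
    (by cases h : O e <;> simpa [head, h] using he) (by cases h : O f <;> simpa [head, h] using hf)
  exact congrArg Prod.fst h

theorem IsPerfect.exists_tail_eq_left {Γ : PlabicGraph n V E} {O : E → Bool} (h : Γ.IsPerfect O)
    (i : Fin n) : ∃ e, Γ.tail O e = .left i := by
  obtain ⟨⟨e, b⟩, he, -⟩ := Γ.left_univalent i
  have := h.left_source e i
  refine ⟨e, ?_⟩
  cases hO : O e <;> cases b <;> simp_all [head, tail]

theorem tail_not (Γ : PlabicGraph n V E) (O : E → Bool) (e : E) :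
    Γ.tail (fun e => !O e) e = Γ.head O e := by
  cases h : O e <;> simp [head, tail, h]

theorem head_not (Γ : PlabicGraph n V E) (O : E → Bool) (e : E) :
    Γ.head (fun e => !O e) e = Γ.tail O e := by
  cases h : O e <;> simp [head, tail, h]

/-! ### Flows and reversal of edges -/

/-- `σ` describes a family of disjoint directed paths from the left side to the right side and
disjoint directed cycles: it maps a left vertex to the first edge of its path, and an edge of the
family to the next edge or to the right vertex in which it ends. The other edges are fixed. -/
structure IsFlow (Γ : PlabicGraph n V E) (O : E → Bool) (σ : Equiv.Perm (E ⊕ Fin n)) : Prop where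
  step : ∀ e f, σ (.inl e) = .inl f → f ≠ e → Γ.head O e = Γ.tail O f
  finish : ∀ e j, σ (.inl e) = .inr j → Γ.head O e = .right j
  start : ∀ i f, σ (.inr i) = .inl f → Γ.tail O f = .left i
  inr_ne : ∀ i j, σ (.inr i) ≠ .inr j

open Classical in
/-- Reversing the edges of a flow. -/
noncomputable def flipAlong (O : E → Bool) (σ : Equiv.Perm (E ⊕ Fin n)) (e : E) : Bool :=
  if σ (.inl e) = .inl e then O e else !O e

theorem tail_flipAlong_of_eq (Γ : PlabicGraph n V E) {O : E → Bool} {σ : Equiv.Perm (E ⊕ Fin n)}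
    {e : E} (h : σ (.inl e) = .inl e) : Γ.tail (flipAlong O σ) e = Γ.tail O e := by
  simp [tail, flipAlong, h]

theorem head_flipAlong_of_eq (Γ : PlabicGraph n V E) {O : E → Bool} {σ : Equiv.Perm (E ⊕ Fin n)}
    {e : E} (h : σ (.inl e) = .inl e) : Γ.head (flipAlong O σ) e = Γ.head O e := by
  simp [head, flipAlong, h]

theorem tail_flipAlong_of_ne (Γ : PlabicGraph n V E) {O : E → Bool} {σ : Equiv.Perm (E ⊕ Fin n)}
    {e : E} (h : σ (.inl e) ≠ .inl e) : Γ.tail (flipAlong O σ) e = Γ.head O e := by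
  rw [← tail_not]
  simp [tail, flipAlong, h]

theorem head_flipAlong_of_ne (Γ : PlabicGraph n V E) {O : E → Bool} {σ : Equiv.Perm (E ⊕ Fin n)}
    {e : E} (h : σ (.inl e) ≠ .inl e) : Γ.head (flipAlong O σ) e = Γ.tail O e := by
  rw [← head_not]
  simp [head, flipAlong, h]

theorem IsFlow.exists_next {Γ : PlabicGraph n V E} {O : E → Bool} {σ : Equiv.Perm (E ⊕ Fin n)}
    (hσ : Γ.IsFlow O σ) {e : E} {v : V} (he : σ (.inl e) ≠ .inl e) (hv : Γ.head O e = .inner v) :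
    ∃ f, σ (.inl e) = .inl f ∧ σ (.inl f) ≠ .inl f ∧ Γ.tail O f = .inner v := by
  cases h : σ (.inl e) with
  | inl f =>
    have hfe : f ≠ e := by
      rintro rfl
      exact he h
    refine ⟨f, rfl, fun hf => hfe ?_, (hσ.step e f h hfe).symm.trans hv⟩
    exact Sum.inl_injective (σ.injective (hf.trans h.symm))
  | inr j =>
    rw [hσ.finish e j h] at hv
    cases hv

theorem IsFlow.exists_prev {Γ : PlabicGraph n V E} {O : E → Bool} {σ : Equiv.Perm (E ⊕ Fin n)}
    (hσ : Γ.IsFlow O σ) {f : E} {v : V} (hf : σ (.inl f) ≠ .inl f) (hv : Γ.tail O f = .inner v) :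
    ∃ e, σ (.inl e) = .inl f ∧ σ (.inl e) ≠ .inl e ∧ Γ.head O e = .inner v := by
  obtain ⟨x, hx⟩ := σ.surjective (.inl f)
  cases x with
  | inl e =>
    have hfe : f ≠ e := by
      rintro rfl
      exact hf hx
    exact ⟨e, hx, fun h => hfe (Sum.inl_injective (hx.symm.trans h)),
      (hσ.step e f hx hfe).trans hv⟩
  | inr i =>
    rw [hσ.start i f hx] at hv
    cases hv

/-- At a black vertex let `a` be its unique outgoing edge. Any flow edge entering must continue
through `a`. If `a` is not in the flow, then no flow edge enters, and after reversal `a` is the only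
incoming edge. If `a` is in the flow, its predecessor is the only incoming edge, by injectivity of
`σ`. White vertices are dual. Each boundary edge lies in the flow, so it keeps its direction. -/
theorem IsFlow.perfectlyOrientable_colorSwap {Γ : PlabicGraph n V E} {O : E → Bool}
    {σ : Equiv.Perm (E ⊕ Fin n)} (hσ : Γ.IsFlow O σ) (hO : Γ.IsPerfect O) :
    Γ.colorSwap.PerfectlyOrientable := by
  -- Two reversals cancel on the flow: this orientation equals `O` on flow edges and is opposite to
  -- `O` elsewhere.
  refine ⟨fun e => !flipAlong O σ e, ?_, ?_, ?_, ?_⟩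
  · intro e i
    change Γ.head (fun e => !flipAlong O σ e) e ≠ _
    rw [head_not]
    by_cases he : σ (.inl e) = .inl e
    · rw [tail_flipAlong_of_eq Γ he]
      intro ht
      cases hs : σ (.inr i) with
      | inl f =>
        obtain rfl := eq_of_tail_eq_left ht (hσ.start i f hs)
        cases σ.injective (hs.trans he.symm)
      | inr j => exact hσ.inr_ne i j hs
    · rw [tail_flipAlong_of_ne Γ he]
      exact hO.left_source e i
  · intro e j
    change Γ.tail (fun e => !flipAlong O σ e) e ≠ _
    rw [tail_not]
    by_cases he : σ (.inl e) = .inl e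
    · rw [head_flipAlong_of_eq Γ he]
      intro ht
      obtain ⟨x, hx⟩ := σ.surjective (.inr j)
      cases x with
      | inl f =>
        obtain rfl := eq_of_head_eq_right ht (hσ.finish f j hx)
        cases hx.symm.trans he
      | inr i => exact hσ.inr_ne i j hx
    · rw [head_flipAlong_of_ne Γ he]
      exact hO.right_sink e j
  · intro v hv
    have hb : Γ.color v = .black := by
      change (Γ.color v).swap = _ at hv
      cases h : Γ.color v <;> simp_all [PlabicColor.swap]
    obtain ⟨a, ha, hu⟩ := hO.black v hb
    change ∃! e, Γ.head (fun e => !flipAlong O σ e) e = .inner v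
    simp only [head_not]
    by_cases haD : σ (.inl a) = .inl a
    · refine ⟨a, (tail_flipAlong_of_eq Γ haD).trans ha, fun e he => ?_⟩
      by_cases heD : σ (.inl e) = .inl e
      · exact hu e ((tail_flipAlong_of_eq Γ heD).symm.trans he)
      · obtain ⟨f, -, hf, hfv⟩ :=
          hσ.exists_next heD ((tail_flipAlong_of_ne Γ heD).symm.trans he)
        obtain rfl := hu f hfv
        exact absurd haD hf
    · obtain ⟨g, hg, hgD, hgv⟩ := hσ.exists_prev haD ha
      refine ⟨g, (tail_flipAlong_of_ne Γ hgD).trans hgv, fun e he => ?_⟩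
      by_cases heD : σ (.inl e) = .inl e
      · obtain rfl := hu e ((tail_flipAlong_of_eq Γ heD).symm.trans he)
        exact absurd heD haD
      · obtain ⟨f, hf, -, hfv⟩ :=
          hσ.exists_next heD ((tail_flipAlong_of_ne Γ heD).symm.trans he)
        obtain rfl := hu f hfv
        exact Sum.inl_injective (σ.injective (hf.trans hg.symm))
  · intro v hv
    have hb : Γ.color v = .white := by
      change (Γ.color v).swap = _ at hv
      cases h : Γ.color v <;> simp_all [PlabicColor.swap]
    obtain ⟨a, ha, hu⟩ := hO.white v hb
    change ∃! e, Γ.tail (fun e => !flipAlong O σ e) e = .inner v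
    simp only [tail_not]
    by_cases haD : σ (.inl a) = .inl a
    · refine ⟨a, (head_flipAlong_of_eq Γ haD).trans ha, fun e he => ?_⟩
      by_cases heD : σ (.inl e) = .inl e
      · exact hu e ((head_flipAlong_of_eq Γ heD).symm.trans he)
      · obtain ⟨f, -, hf, hfv⟩ :=
          hσ.exists_prev heD ((head_flipAlong_of_ne Γ heD).symm.trans he)
        obtain rfl := hu f hfv
        exact absurd haD hf
    · obtain ⟨g, hg, hgD, hgv⟩ := hσ.exists_next haD ha
      refine ⟨g, (head_flipAlong_of_ne Γ hgD).trans hgv, fun e he => ?_⟩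
      by_cases heD : σ (.inl e) = .inl e
      · obtain rfl := hu e ((head_flipAlong_of_eq Γ heD).symm.trans he)
        exact absurd heD haD
      · obtain ⟨f, hf, -, hfv⟩ :=
          hσ.exists_prev heD ((head_flipAlong_of_ne Γ heD).symm.trans he)
        obtain rfl := hu f hfv
        exact Sum.inl_injective (hf.symm.trans hg)

-- Every factor of a non-zero Leibniz term is a non-zero matrix entry, hence an admissible
-- transition; the zero lower right block forbids `inr` to `inr`. A fixed edge counts as unused,
-- whichever summand of its diagonal entry is present.
open TransferMatrix in
theorem exists_isFlow_of_det_block_ne_zero [Fintype E] [DecidableEq E] (Γ : PlabicGraph n V E)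
    (O : E → Bool) {S : Type*} [CommRing S] [Algebra ℂ S] (x : E → S)
    (h : (block (Γ.stepPhase O) (Γ.startPhase O) (Γ.endPhase O) x).det ≠ 0) :
    ∃ σ, Γ.IsFlow O σ := by
  -- Transposing puts the factors in the form `M a (σ a)`, so that `σ` points forward along the
  -- paths.
  rw [← Matrix.det_transpose, Matrix.det_apply] at h
  obtain ⟨σ, -, hσ⟩ := Finset.exists_ne_zero_of_sum_ne_zero h
  have key : ∀ a, block (Γ.stepPhase O) (Γ.startPhase O) (Γ.endPhase O) x a (σ a) ≠ 0 := by
    intro a ha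
    exact hσ (by rw [Finset.prod_eq_zero (Finset.mem_univ a) ha, smul_zero])
  refine ⟨σ, ⟨fun e f hf hfe => ?_, fun e j hj => ?_, fun i f hf => ?_, fun i j hj => ?_⟩⟩
  · have := key (.inl e)
    rw [hf] at this
    rw [← stepPhase_ne_zero_iff]
    intro h0
    simp [block, weighted, h0, hfe.symm] at this
  · have := key (.inl e)
    rw [hj] at this
    rw [← endPhase_ne_zero_iff]
    intro h0
    simp [block, h0] at this
  · have := key (.inr i)
    rw [hf] at this
    rw [← startPhase_ne_zero_iff]
    intro h0
    simp [block, weighted, h0] at this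
  · have := key (.inr i)
    rw [hj] at this
    simp [block] at this

/-! ### The determinant does not vanish if both graphs are perfectly orientable -/

open Classical in
/-- The block matrix with the columns of the edges homogenized. -/
noncomputable def flowMatrix (Γ : PlabicGraph n V E) (O : E → Bool) (y x : E → ℂ) :
    Matrix (E ⊕ Fin n) (E ⊕ Fin n) ℂ :=
  Matrix.fromBlocks (Matrix.of fun e f => (if e = f then y f else 0) - Γ.stepPhase O e f * x f)
    (Matrix.of (Γ.endPhase O)) (Matrix.of fun i f => -(Γ.startPhase O i f * x f)) 0

variable [Fintype E]

-- Each edge column is scaled by its `y`. The homogenized matrix still makes sense at `y e = 0`,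
-- which stands for infinite weight on `e`.
open Classical in
theorem det_flowMatrix (Γ : PlabicGraph n V E) (O : E → Bool) (y x : E → ℂ) (hy : ∀ e, y e ≠ 0) :
    (Γ.flowMatrix O y x).det =
      (TransferMatrix.block (Γ.stepPhase O) (Γ.startPhase O) (Γ.endPhase O)
        fun e => x e / y e).det * ∏ e, y e := by
  have h : Γ.flowMatrix O y x = TransferMatrix.block (Γ.stepPhase O) (Γ.startPhase O)
      (Γ.endPhase O) (fun e => x e / y e) * Matrix.diagonal (Sum.elim y fun _ => 1) := by
    ext a b
    rw [Matrix.mul_diagonal]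
    rcases a with e | i <;> rcases b with f | j
    · have := hy f
      simp only [flowMatrix, TransferMatrix.block, TransferMatrix.weighted,
        Matrix.fromBlocks_apply₁₁, Matrix.of_apply, Matrix.sub_apply, Matrix.one_apply,
        Sum.elim_inl, Algebra.algebraMap_self, RingHom.id_apply]
      split_ifs <;> field_simp
      simp
    · simp [flowMatrix, TransferMatrix.block]
    · have := hy f
      simp only [flowMatrix, TransferMatrix.block, TransferMatrix.weighted,
        Matrix.fromBlocks_apply₂₁, Matrix.of_apply, Matrix.neg_apply,
        Sum.elim_inl, Algebra.algebraMap_self, RingHom.id_apply]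
      field_simp
    · simp [flowMatrix, TransferMatrix.block]
  rw [h, Matrix.det_mul, Matrix.det_diagonal, Fintype.prod_sum_type]
  simp

-- A vector `v` in the left kernel vanishes entry by entry. The column of an edge on which `O` and
-- `O'` differ is a unit vector. Every agreeing edge has a following agreeing edge, or a right
-- vertex, whose column meets no other row on which `v` may be non-zero; the first edge from a left
-- vertex plays the same role for the row of that vertex.
open Classical in
theorem det_flowMatrix_ne_zero (Γ : PlabicGraph n V E) {O O' : E → Bool} (hO : Γ.IsPerfect O)
    (hO' : Γ.colorSwap.IsPerfect O') :
    (Γ.flowMatrix O (fun e => if O e = O' e then 0 else 1)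
      (fun e => if O e = O' e then 1 else 0)).det ≠ 0 := by
  set M := Γ.flowMatrix O (fun e => if O e = O' e then 0 else 1)
    (fun e => if O e = O' e then 1 else 0) with hM
  intro h0
  obtain ⟨v, hv, hvM⟩ := Matrix.exists_vecMul_eq_zero_iff.2 h0
  have col : ∀ b, ∑ e, v (.inl e) * M (.inl e) b + ∑ i, v (.inr i) * M (.inr i) b = 0 := by
    intro b
    have := congrFun hvM b
    rwa [Matrix.vecMul, dotProduct, Fintype.sum_sum_type] at this
  have hsame_tail : ∀ e, O e = O' e → Γ.tail O' e = Γ.tail O e := fun e h => by simp [tail, h]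
  have hsame_head : ∀ e, O e = O' e → Γ.head O' e = Γ.head O e := fun e h => by simp [head, h]
  have hdiff_tail : ∀ e, O e ≠ O' e → Γ.tail O' e = Γ.head O e := fun e h => by
    cases h1 : O e <;> cases h2 : O' e <;> simp_all [head, tail]
  have hdiff_head : ∀ e, O e ≠ O' e → Γ.head O' e = Γ.tail O e := fun e h => by
    cases h1 : O e <;> cases h2 : O' e <;> simp_all [head, tail]
  -- edges which are not reversed
  have hout : ∀ e, O e ≠ O' e → v (.inl e) = 0 := by
    intro e he
    simpa [hM, flowMatrix, he] using col (.inl e)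
  -- If `e` is the only agreeing predecessor of `f`, the column of `f` reduces to a non-zero
  -- multiple of `v (.inl e)`.
  have hstep : ∀ e f, O e = O' e → O f = O' f → Γ.head O e = Γ.tail O f →
      (∀ e', O e' = O' e' → Γ.head O e' = Γ.tail O f → e' = e) → (∀ i, Γ.tail O f ≠ .left i) →
      v (.inl e) = 0 := by
    intro e f he hf hef hu hl
    have h1 := col (.inl f)
    rw [Finset.sum_eq_single e, Finset.sum_eq_zero, add_zero] at h1
    · have : M (.inl e) (.inl f) = - Γ.stepPhase O e f := by simp [hM, flowMatrix, hf]
      rw [this] at h1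
      simpa [stepPhase_ne_zero_iff.2 hef] using h1
    · intro i _
      have : Γ.startPhase O i f = 0 := by
        by_contra hne
        exact hl i (startPhase_ne_zero_iff.1 hne)
      simp [hM, flowMatrix, this]
    · intro e' _ hne
      by_cases he' : O e' = O' e'
      · have : Γ.stepPhase O e' f = 0 := by
          by_contra h2
          exact hne (hu e' he' (stepPhase_ne_zero_iff.1 h2))
        simp [hM, flowMatrix, this, hf]
      · rw [hout e' he', zero_mul]
    · simp
  refine hv (funext fun a => ?_)
  rcases a with e | i
  · by_cases he : O e = O' e
    swap
    · exact hout e he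
    cases hh : Γ.head O e with
    | left i => exact absurd hh (hO.left_source e i)
    | right j =>
      have h1 := col (.inr j)
      rw [Finset.sum_eq_single e, Finset.sum_eq_zero, add_zero] at h1
      · have : M (.inl e) (.inr j) = Γ.endPhase O e j := by simp [hM, flowMatrix]
        rw [this] at h1
        simpa [endPhase_ne_zero_iff.2 hh] using h1
      · intro i _
        simp [hM, flowMatrix]
      · intro e' _ hne
        have : Γ.endPhase O e' j = 0 := by
          by_contra h2
          exact hne (eq_of_head_eq_right (endPhase_ne_zero_iff.1 h2) hh)
        simp [hM, flowMatrix, this]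
      · simp
    | inner v =>
      -- The next edge `f` is the unique outgoing edge at the vertex, for `O'` if it is white and
      -- for `O` if it is black. Were `f` not agreeing, it would enter the vertex in the other
      -- orientation, where `e` is the unique incoming edge.
      cases hc : Γ.color v with
      | white =>
        obtain ⟨f, hf, -⟩ := hO'.black v (by
          change (Γ.color v).swap = _
          rw [hc]; rfl)
        change Γ.tail O' f = _ at hf
        obtain ⟨a, -, hu⟩ := hO.white v hc
        have hfD : O f = O' f := by
          by_contra hne
          have h1 : Γ.head O f = .inner v := (hdiff_tail f hne).symm.trans hf
          obtain rfl := (hu f h1).trans (hu e hh).symm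
          exact hne he
        rw [hsame_tail f hfD] at hf
        refine hstep e f he hfD (hh.trans hf.symm) (fun e' _ h' => ?_) (by simp [hf])
        exact (hu e' (h'.trans hf)).trans (hu e hh).symm
      | black =>
        obtain ⟨f, hf, huf⟩ := hO.black v hc
        obtain ⟨a, -, hu⟩ := hO'.white v (by
          change (Γ.color v).swap = _
          rw [hc]; rfl)
        change ∀ y, Γ.head O' y = _ → _ at hu
        have heu := hu e ((hsame_head e he).trans hh)
        have hfD : O f = O' f := by
          by_contra hne
          obtain rfl := (hu f ((hdiff_head f hne).trans hf)).trans heu.symm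
          exact hne he
        refine hstep e f he hfD (hh.trans hf.symm) (fun e' he' h' => ?_) (by simp [hf])
        exact (hu e' ((hsame_head e' he').trans (h'.trans hf))).trans heu.symm
  · obtain ⟨f, hf⟩ := hO.exists_tail_eq_left i
    have hfD : O f = O' f := by
      by_contra hne
      exact hO'.left_source f i ((hdiff_head f hne).trans hf)
    have h1 := col (.inl f)
    rw [Finset.sum_eq_zero, zero_add, Finset.sum_eq_single i] at h1
    · have : M (.inr i) (.inl f) = -Γ.startPhase O i f := by simp [hM, flowMatrix, hfD]
      rw [this] at h1
      simpa [startPhase_ne_zero_iff.2 hf] using h1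
    · intro i' _ hne
      have : Γ.startPhase O i' f = 0 := by
        by_contra h2
        have := (startPhase_ne_zero_iff.1 h2).symm.trans hf
        exact hne (by injection this)
      simp [hM, flowMatrix, this]
    · simp
    · intro e _
      have : Γ.stepPhase O e f = 0 := by
        by_contra h2
        exact hO.left_source e i ((stepPhase_ne_zero_iff.1 h2).trans hf)
      simp [hM, flowMatrix, this, hfD]

-- The matrix at `s = 0` is invertible, hence so is the one at some small `s ≠ 0`, where the
-- homogenization can be undone: the weights are `1 / s` on agreeing edges and `0` on the others.
open Classical in
theorem exists_det_block_ne_zero (Γ : PlabicGraph n V E) {O : E → Bool} (hO : Γ.IsPerfect O)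
    (hΓ : Γ.colorSwap.PerfectlyOrientable) : ∃ x : E → ℂ,
      (TransferMatrix.block (Γ.stepPhase O) (Γ.startPhase O) (Γ.endPhase O) x).det ≠ 0 := by
  obtain ⟨O', hO'⟩ := hΓ
  let y : ℂ → E → ℂ := fun s e => if O e = O' e then s else 1
  let x : E → ℂ := fun e => if O e = O' e then 1 else 0
  have hcont : Continuous fun s => (Γ.flowMatrix O (y s) x).det := by
    refine Continuous.matrix_det ?_
    refine Continuous.matrix_fromBlocks ?_ continuous_const continuous_const continuous_const
    refine continuous_matrix fun e f => ?_
    simp only [Matrix.of_apply, y]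
    split_ifs <;> fun_prop
  have h0 : ∀ᶠ s in 𝓝[≠] (0 : ℂ), (Γ.flowMatrix O (y s) x).det ≠ 0 :=
    (hcont.continuousAt.eventually_ne (Γ.det_flowMatrix_ne_zero hO hO')).filter_mono
      nhdsWithin_le_nhds
  obtain ⟨s, hs, hs0⟩ := (h0.and self_mem_nhdsWithin).exists
  have hy : ∀ e, y s e ≠ 0 := by
    intro e
    simp only [y]
    split_ifs
    · exact hs0
    · exact one_ne_zero
  rw [Γ.det_flowMatrix O _ _ hy] at hs
  exact ⟨_, left_ne_zero_of_mul hs⟩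

end PlabicGraph

namespace PlabicGraph

variable {n : ℕ} {V E : Type*}

/-! ### The faces on the two sides of an edge -/

theorem polyPoint_mem (p : ℂ) (l : List ℂ) (q : ℂ) {k : ℕ} (hk : k < l.length + 2) :
    polyPoint p l q k ∈ p :: (l ++ [q]) := by
  have hk' : k < (p :: (l ++ [q])).length := by
    rw [List.length_cons, List.length_append, List.length_singleton]
    exact hk
  rw [polyPoint, List.getD_eq_getElem _ _ hk']
  exact List.getElem_mem _

theorem notMem_of_forall_ne {Γ : PlabicGraph n V E} {z : ℂ} (h1 : ∀ v, Γ.pos v ≠ z)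
    (h2 : ∀ e, z ∉ Γ.bends e) (e : E) {k : ℕ} (hk : k < (Γ.bends e).length + 2) :
    polyPoint (Γ.pos (Γ.src e)) (Γ.bends e) (Γ.pos (Γ.tgt e)) k ≠ z := by
  rintro rfl
  have := polyPoint_mem (Γ.pos (Γ.src e)) (Γ.bends e) (Γ.pos (Γ.tgt e)) hk
  rw [List.mem_cons, List.mem_append, List.mem_singleton] at this
  rcases this with h | h | h
  · exact h1 _ h.symm
  · exact h2 _ h
  · exact h1 _ h.symm

/-- Near a point of an open segment there are no other points of the graph. -/
theorem eventually_image_subset_segment [Finite V] [Finite E] (Γ : PlabicGraph n V E)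
    (s : Σ e, Fin ((Γ.bends e).length + 1)) {z : ℂ}
    (hz : z ∈ polyOpenSegment (Γ.pos (Γ.src s.1)) (Γ.bends s.1) (Γ.pos (Γ.tgt s.1)) s.2) :
    ∀ᶠ y in 𝓝 z, y ∈ Γ.image →
      y ∈ segment ℝ (polyPoint (Γ.pos (Γ.src s.1)) (Γ.bends s.1) (Γ.pos (Γ.tgt s.1)) s.2)
        (polyPoint (Γ.pos (Γ.src s.1)) (Γ.bends s.1) (Γ.pos (Γ.tgt s.1)) (s.2 + 1)) := by
  have h1 : ∀ v, Γ.pos v ≠ z := by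
    rintro v rfl
    exact Γ.pos_notMem s v hz
  have h2 : ∀ e, z ∉ Γ.bends e := fun e he => Γ.bend_notMem s e z he hz
  have hfin : Finite (PlabicVertex n V) :=
    Finite.of_surjective (α := Fin n ⊕ Fin n ⊕ V)
      (Sum.elim .left (Sum.elim .right .inner)) (by
        rintro (i | i | v)
        exacts [⟨.inl i, rfl⟩, ⟨.inr (.inl i), rfl⟩, ⟨.inr (.inr v), rfl⟩])
  have hpos : ∀ᶠ y in 𝓝 z, y ∉ Set.range Γ.pos := by
    refine (Set.finite_range Γ.pos).isClosed.isOpen_compl.mem_nhds ?_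
    rintro ⟨v, hv⟩
    exact h1 v hv
  have hseg : ∀ t : Σ e, Fin ((Γ.bends e).length + 1), ∀ᶠ y in 𝓝 z, t ≠ s →
      y ∉ segment ℝ (polyPoint (Γ.pos (Γ.src t.1)) (Γ.bends t.1) (Γ.pos (Γ.tgt t.1)) t.2)
        (polyPoint (Γ.pos (Γ.src t.1)) (Γ.bends t.1) (Γ.pos (Γ.tgt t.1)) (t.2 + 1)) := by
    intro t
    by_cases hts : t = s
    · exact .of_forall fun y h => absurd hts h
    have hcl : IsClosed (segment ℝ
        (polyPoint (Γ.pos (Γ.src t.1)) (Γ.bends t.1) (Γ.pos (Γ.tgt t.1)) t.2)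
        (polyPoint (Γ.pos (Γ.src t.1)) (Γ.bends t.1) (Γ.pos (Γ.tgt t.1)) (t.2 + 1))) := by
      rw [← convexHull_pair]
      exact (Set.toFinite _).isClosed_convexHull ℝ
    refine Filter.Eventually.mono (hcl.isOpen_compl.mem_nhds ?_) fun y hy _ => hy
    rw [Set.mem_compl_iff, ← insert_endpoints_openSegment, Set.mem_insert_iff,
      Set.mem_insert_iff]
    rintro (h | h | h)
    · exact notMem_of_forall_ne h1 h2 t.1 (by omega) h.symm
    · exact notMem_of_forall_ne h1 h2 t.1 (by omega) h.symm
    · exact Set.disjoint_left.1 (Γ.segment_disjoint hts) h hz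
  filter_upwards [hpos, Filter.eventually_all.2 hseg] with y hy1 hy2 hy
  rcases hy with hy | hy
  · exact absurd hy hy1
  · obtain ⟨t, ht⟩ := Set.mem_iUnion.1 hy
    by_cases hts : t = s
    · rwa [hts] at ht
    · exact absurd ht (hy2 t hts)

/-- After division by `q - p` the segment becomes real, while the point has imaginary part `± t`. -/
theorem midpoint_add_notMem_segment {p q u : ℂ} (hpq : p ≠ q) (hu : u = q - p ∨ u = p - q)
    {t : ℝ} (ht : 0 < t) : (p + q) / 2 + t * (Complex.I * u) ∉ segment ℝ p q := by
  rw [segment_eq_image']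
  rintro ⟨s, -, hs⟩
  have hqp : q - p ≠ 0 := sub_ne_zero.2 hpq.symm
  simp only [Complex.real_smul] at hs
  rcases hu with rfl | rfl
  · have h : (s - 1 / 2 - t * Complex.I) * (q - p) = 0 := by linear_combination hs
    have := congrArg Complex.im ((mul_eq_zero.1 h).resolve_right hqp)
    simp at this
    exact ht.ne' this
  · have h : (s - 1 / 2 + t * Complex.I) * (q - p) = 0 := by linear_combination hs
    have := congrArg Complex.im ((mul_eq_zero.1 h).resolve_right hqp)
    simp at this
    exact ht.ne' this

/-- Near the midpoint the graph is just one segment, so a short open piece of the normal lies in the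
complement; being connected, it stays in one component. -/
theorem exists_isLeftFace [Finite V] [Finite E] (Γ : PlabicGraph n V E) (O : E → Bool) (e : E) :
    ∃ F, Γ.IsLeftFace O F e := by
  set p : ℂ := Γ.pos (Γ.src e) with hp
  set q : ℂ := polyPoint (Γ.pos (Γ.src e)) (Γ.bends e) (Γ.pos (Γ.tgt e)) 1 with hq
  set u : ℂ := if O e then q - p else p - q with hu_def
  have hu : u = q - p ∨ u = p - q := by
    rw [hu_def]
    split_ifs <;> simp
  have h0 : polyPoint (Γ.pos (Γ.src e)) (Γ.bends e) (Γ.pos (Γ.tgt e)) 0 = p := by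
    simp [polyPoint, hp]
  have hpq : p ≠ q := by
    intro h
    refine Γ.pos_notMem ⟨e, 0⟩ (Γ.src e) ?_
    change p ∈ openSegment ℝ (polyPoint _ _ _ 0) q
    rw [h0, ← h, openSegment_same]
    rfl
  have hm : (p + q) / 2 ∈
      polyOpenSegment (Γ.pos (Γ.src e)) (Γ.bends e) (Γ.pos (Γ.tgt e)) 0 := by
    change _ ∈ openSegment ℝ (polyPoint _ _ _ 0) q
    rw [h0]
    refine ⟨1 / 2, 1 / 2, by norm_num, by norm_num, by norm_num, ?_⟩
    simp only [Complex.real_smul]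
    push_cast
    ring
  have hrect : ∀ᶠ y in 𝓝 ((p + q) / 2),
      y ∈ Set.Ioo Γ.lo.re Γ.hi.re ×ℂ Set.Ioo Γ.lo.im Γ.hi.im :=
    (isOpen_Ioo.reProdIm isOpen_Ioo).mem_nhds (Γ.segment_subset ⟨e, 0⟩ hm)
  have hline : Continuous fun t : ℝ => (p + q) / 2 + t * (Complex.I * u) := by fun_prop
  have htend : Filter.Tendsto (fun t : ℝ => (p + q) / 2 + t * (Complex.I * u)) (𝓝 0)
      (𝓝 ((p + q) / 2)) := by
    have := hline.tendsto 0
    simpa using this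
  have hev := htend.eventually (hrect.and (Γ.eventually_image_subset_segment ⟨e, 0⟩ hm))
  obtain ⟨δ, hδ, hball⟩ := Metric.eventually_nhds_iff.1 hev
  have hmem : ∀ t : Set.Ioo 0 δ, (p + q) / 2 + (t : ℝ) * (Complex.I * u) ∈ Γ.compl := by
    rintro ⟨t, ht0, ht1⟩
    obtain ⟨h1, h2⟩ := hball (y := t) (by rwa [Real.dist_eq, sub_zero, abs_of_pos ht0])
    refine ⟨⟨Set.Ioo_subset_Icc_self h1.1, Set.Ioo_subset_Icc_self h1.2⟩, fun h => ?_⟩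
    refine midpoint_add_notMem_segment hpq hu ht0 ?_
    have := h2 h
    change _ ∈ segment ℝ (polyPoint _ _ _ 0) q at this
    rwa [h0] at this
  let γ : Set.Ioo 0 δ → Γ.compl := fun t => ⟨_, hmem t⟩
  have hγ : Continuous γ := (hline.comp continuous_subtype_val).subtype_mk _
  have : PreconnectedSpace (Set.Ioo 0 δ) := Subtype.preconnectedSpace isPreconnected_Ioo
  let t₀ : Set.Ioo 0 δ := ⟨δ / 2, by simpa using hδ, by simpa using hδ⟩
  refine ⟨ConnectedComponents.mk (γ t₀), ?_⟩
  change ∀ᶠ t : ℝ in 𝓝[>] 0, ∃ h : (p + q) / 2 + t * (Complex.I * u) ∈ Γ.compl,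
    ConnectedComponents.mk (⟨_, h⟩ : Γ.compl) = _
  filter_upwards [Ioo_mem_nhdsGT hδ] with t ht
  refine ⟨hmem ⟨t, ht⟩, ?_⟩
  rw [ConnectedComponents.coe_eq_coe']
  exact (isPreconnected_range hγ).subset_connectedComponent (Set.mem_range_self t₀)
    (Set.mem_range_self (⟨t, ht⟩ : Set.Ioo 0 δ))

theorem IsLeftFace.unique {Γ : PlabicGraph n V E} {O : E → Bool} {e : E} {F G : Γ.Face}
    (hF : Γ.IsLeftFace O F e) (hG : Γ.IsLeftFace O G e) : F = G := by
  obtain ⟨t, ⟨_, h1⟩, ⟨_, h2⟩⟩ := (hF.and hG).exists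
  exact h1.symm.trans h2

/-- Each edge has one face on its left and one on its right, possibly equal, and contributes `w e`
to the former and its inverse to the latter. -/
theorem finprod_faceWeight [Finite V] [Fintype E] (Γ : PlabicGraph n V E) (O : E → Bool)
    (w : E → ℂˣ) : ∏ᶠ F, Γ.faceWeight O w F = 1 := by
  classical
  choose l hl using Γ.exists_isLeftFace O
  choose r hr using Γ.exists_isLeftFace fun e => !O e
  have hfac : ∀ e F, w e ^ Γ.faceExponent O F e =
      (if F = l e then w e else 1) * (if F = r e then (w e)⁻¹ else 1) := by
    intro e F
    have h1 : Γ.IsLeftFace O F e ↔ F = l e :=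
      ⟨fun h => h.unique (hl e), fun h => h ▸ hl e⟩
    have h2 : Γ.IsLeftFace (fun e => !O e) F e ↔ F = r e :=
      ⟨fun h => h.unique (hr e), fun h => h ▸ hr e⟩
    rw [faceExponent, zpow_sub]
    simp only [h1, h2]
    split_ifs <;> simp
  have hs1 : ∀ e, (Function.mulSupport fun F => if F = l e then w e else 1).Finite := fun e =>
    (Set.finite_singleton (l e)).subset fun F hF => by
      by_contra h
      exact hF (if_neg h)
  have hs2 : ∀ e, (Function.mulSupport fun F => if F = r e then (w e)⁻¹ else 1).Finite := fun e =>
    (Set.finite_singleton (r e)).subset fun F hF => by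
      by_contra h
      exact hF (if_neg h)
  unfold faceWeight
  simp only [hfac]
  rw [finprod_prod_comm]
  · refine Finset.prod_eq_one fun e _ => ?_
    rw [finprod_mul_distrib (hs1 e) (hs2 e), finprod_eq_single _ (l e) fun F hF => if_neg hF,
      finprod_eq_single _ (r e) fun F hF => if_neg hF]
    simp
  · intro e _
    exact ((hs1 e).union (hs2 e)).subset (Function.mulSupport_mul _ _)

end PlabicGraph

namespace PlabicGraph

open TransferMatrix

variable {n : ℕ} {V E : Type*} [Fintype E]

/-! ### Boundary measurements in terms of transfer matrices -/

theorem weighted_startPhase_mul (Γ : PlabicGraph n V E) (O : E → Bool) :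
    weighted (Γ.startPhase O) (MvPowerSeries.X : E → MvPowerSeries E ℂ) *
      (Matrix.of fun e j => listSeries (Γ.restPhase O j e)) = Matrix.of (Γ.pathSeries O) := by
  ext1 i j
  rw [Matrix.of_apply, pathSeries_eq_sum]
  simp [Matrix.mul_apply, weighted, MvPowerSeries.algebraMap_apply]

theorem one_sub_weighted_stepPhase_mul [DecidableEq E] (Γ : PlabicGraph n V E) (O : E → Bool) :
    (1 - weighted (Γ.stepPhase O) (MvPowerSeries.X : E → MvPowerSeries E ℂ)) *
      (Matrix.of fun e j => listSeries (Γ.restPhase O j e)) =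
        Matrix.of fun e j => algebraMap ℂ (MvPowerSeries E ℂ) (Γ.endPhase O e j) := by
  rw [Matrix.sub_mul, Matrix.one_mul, sub_eq_iff_eq_add]
  ext1 e j
  rw [Matrix.of_apply, listSeries_restPhase]
  simp [Matrix.mul_apply, weighted, MvPowerSeries.algebraMap_apply]

/-- The transfer matrix has no constant terms, so the determinant has constant coefficient `1`. -/
theorem isUnit_det_one_sub_weighted_X [DecidableEq E] (k : E → E → ℂ) :
    IsUnit (1 - weighted k (MvPowerSeries.X : E → MvPowerSeries E ℂ)).det := by
  have h : (1 - weighted k (MvPowerSeries.X : E → MvPowerSeries E ℂ)).map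
      (MvPowerSeries.constantCoeff (σ := E) (R := ℂ)) = 1 := by
    ext e f
    by_cases hef : e = f <;> simp [weighted, Matrix.one_apply, hef]
  rw [MvPowerSeries.isUnit_iff_constantCoeff, RingHom.map_det]
  rw [← RingHom.mapMatrix_apply] at h
  rw [h, Matrix.det_one]
  exact isUnit_one

theorem det_block_X [DecidableEq E] (Γ : PlabicGraph n V E) (O : E → Bool) :
    (block (Γ.stepPhase O) (Γ.startPhase O) (Γ.endPhase O)
      (MvPowerSeries.X : E → MvPowerSeries E ℂ)).det =
      (1 - weighted (Γ.stepPhase O) (MvPowerSeries.X : E → MvPowerSeries E ℂ)).det *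
        (Matrix.of (Γ.pathSeries O)).det := by
  have hu := isUnit_det_one_sub_weighted_X (Γ.stepPhase O)
  rw [det_block _ _ _ _ hu, ← one_sub_weighted_stepPhase_mul,
    Matrix.nonsing_inv_mul_cancel_left _ _ hu, weighted_startPhase_mul]

/-- Cramer's rule, with the adjugate in place of the inverse so that both sides come from
polynomials. It exhibits every path series as a rational function with the common denominator `det
(1 - K)`. -/
theorem coe_det_mul_pathSeries [DecidableEq E] (Γ : PlabicGraph n V E) (O : E → Bool)
    (i j : Fin n) :
    ((1 - weighted (Γ.stepPhase O) (MvPolynomial.X : E → MvPolynomial E ℂ)).det :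
        MvPowerSeries E ℂ) * Γ.pathSeries O i j =
      ((weighted (Γ.startPhase O) (MvPolynomial.X : E → MvPolynomial E ℂ) *
        ((1 - weighted (Γ.stepPhase O) (MvPolynomial.X : E → MvPolynomial E ℂ)).adjugate *
          Matrix.of fun e j => (MvPolynomial.C (Γ.endPhase O e j) : MvPolynomial E ℂ))) i j :
        MvPolynomial E ℂ) := by
  let φ : MvPolynomial E ℂ →ₐ[ℂ] MvPowerSeries E ℂ := MvPolynomial.coeToMvPowerSeries.algHom ℂ
  have hφ : ∀ P : MvPolynomial E ℂ, (P : MvPowerSeries E ℂ) = φ P := by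
    intro P
    simp [φ, MvPolynomial.coeToMvPowerSeries.algHom_apply]
  have hX : φ ∘ MvPolynomial.X = (MvPowerSeries.X : E → MvPowerSeries E ℂ) := by
    funext e
    simp [← hφ]
  have hK : φ.mapMatrix (1 - weighted (Γ.stepPhase O) MvPolynomial.X) =
      1 - weighted (Γ.stepPhase O) (MvPowerSeries.X : E → MvPowerSeries E ℂ) := by
    rw [AlgHom.mapMatrix_apply, map_one_sub_weighted, hX]
  have hC : (Matrix.of fun e j => (MvPolynomial.C (Γ.endPhase O e j) : MvPolynomial E ℂ)).map φ =
      Matrix.of fun e j => algebraMap ℂ (MvPowerSeries E ℂ) (Γ.endPhase O e j) := by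
    ext1 e j
    simp only [Matrix.map_apply, Matrix.of_apply]
    exact φ.commutes _
  rw [hφ, hφ, AlgHom.map_det, hK, ← Matrix.map_apply (f := φ), Matrix.map_mul, Matrix.map_mul,
    map_weighted, hX, ← AlgHom.mapMatrix_apply, AlgHom.map_adjugate, hK, hC,
    ← one_sub_weighted_stepPhase_mul, ← Matrix.mul_assoc (Matrix.adjugate _),
    Matrix.adjugate_mul, Matrix.smul_mul, Matrix.one_mul, Matrix.mul_smul,
    weighted_startPhase_mul]
  simp

/-! ### The two implications -/

/-- If the determinant does not vanish for some weights, then there is a flow. -/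
theorem IsBoundaryMeasurement.exists_isFlow {Γ : PlabicGraph n V E} {O : E → Bool} {w : E → ℂˣ}
    {A : Matrix (Fin n) (Fin n) ℂ} (hA : Γ.IsBoundaryMeasurement O w A) (hdet : A.det ≠ 0) :
    ∃ σ, Γ.IsFlow O σ := by
  classical
  by_contra hflow
  have hblock : (block (Γ.stepPhase O) (Γ.startPhase O) (Γ.endPhase O)
      (MvPowerSeries.X : E → MvPowerSeries E ℂ)).det = 0 := by
    by_contra h
    exact hflow (exists_isFlow_of_det_block_ne_zero Γ O _ h)
  rw [det_block_X, (isUnit_det_one_sub_weighted_X _).mul_right_eq_zero] at hblock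
  choose P Q hPQ hQ hAPQ using hA
  -- The given fractions may differ from those of Cramer's rule and may be regular where `det (1 -
  -- K)` vanishes. A common denominator turns the path series matrix into a polynomial matrix `M`,
  -- whose vanishing determinant can be evaluated at `w`.
  let D : MvPolynomial E ℂ := ∏ i, ∏ j, Q i j
  have hdvd : ∀ i j, Q i j ∣ D := fun i j =>
    (Finset.dvd_prod_of_mem (fun j => Q i j) (Finset.mem_univ j)).trans
      (Finset.dvd_prod_of_mem (fun i => ∏ j, Q i j) (Finset.mem_univ i))
  choose R hR using hdvd
  let M : Matrix (Fin n) (Fin n) (MvPolynomial E ℂ) := Matrix.of fun i j => P i j * R i j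
  have hD : MvPolynomial.eval (fun e => (w e : ℂ)) D ≠ 0 := by
    simp only [D, map_prod]
    exact Finset.prod_ne_zero_iff.2 fun i _ => Finset.prod_ne_zero_iff.2 fun j _ => hQ i j
  have hM : M.det = 0 := by
    apply MvPolynomial.coe_injective (σ := E) (R := ℂ)
    have h : MvPolynomial.coeToMvPowerSeries.ringHom.mapMatrix M =
        (D : MvPowerSeries E ℂ) • Matrix.of (Γ.pathSeries O) := by
      ext1 i j
      simp only [M, RingHom.mapMatrix_apply, Matrix.map_apply, Matrix.of_apply,
        MvPolynomial.coeToMvPowerSeries.ringHom_apply, MvPolynomial.coe_mul, Matrix.smul_apply,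
        smul_eq_mul]
      rw [← hPQ, hR i j, MvPolynomial.coe_mul]
      ring
    rw [← MvPolynomial.coeToMvPowerSeries.ringHom_apply, RingHom.map_det, h, Matrix.det_smul,
      hblock, mul_zero, MvPolynomial.coe_zero]
  have heval : (MvPolynomial.eval fun e => (w e : ℂ)).mapMatrix M =
      MvPolynomial.eval (fun e => (w e : ℂ)) D • A := by
    ext1 i j
    have := hQ i j
    simp only [M, RingHom.mapMatrix_apply, Matrix.map_apply, Matrix.of_apply, Matrix.smul_apply,
      smul_eq_mul]
    rw [hAPQ, hR i j, map_mul, map_mul]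
    field_simp
  have h := congrArg Matrix.det heval
  rw [← RingHom.map_det, hM, map_zero, Matrix.det_smul] at h
  exact mul_ne_zero (pow_ne_zero _ hD) hdet h.symm

/-- If both graphs are perfectly orientable, then the determinant does not vanish for generic
weights. -/
theorem exists_isBoundaryMeasurement {Γ : PlabicGraph n V E} {O : E → Bool} (hO : Γ.IsPerfect O)
    (hΓ : Γ.colorSwap.PerfectlyOrientable) :
    ∃ (w : E → ℂˣ) (A : Matrix (Fin n) (Fin n) ℂ), Γ.IsBoundaryMeasurement O w A ∧ A.det ≠ 0 := by
  classical
  let K : Matrix E E (MvPolynomial E ℂ) := 1 - weighted (Γ.stepPhase O) MvPolynomial.X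
  let N : MvPolynomial E ℂ := (block (Γ.stepPhase O) (Γ.startPhase O) (Γ.endPhase O)
    (MvPolynomial.X : E → MvPolynomial E ℂ)).det
  have hX : ∀ x : E → ℂ, MvPolynomial.aeval x ∘ (MvPolynomial.X : E → MvPolynomial E ℂ) = x :=
    fun x => funext fun e => MvPolynomial.aeval_X x e
  have hN : ∀ x : E → ℂ, MvPolynomial.aeval x N =
      (block (Γ.stepPhase O) (Γ.startPhase O) (Γ.endPhase O) x).det := by
    intro x
    rw [AlgHom.map_det, AlgHom.mapMatrix_apply, map_block, hX]
  have hK : ∀ x : E → ℂ, (MvPolynomial.aeval x : MvPolynomial E ℂ →ₐ[ℂ] ℂ).mapMatrix K =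
      1 - weighted (Γ.stepPhase O) x := by
    intro x
    rw [AlgHom.mapMatrix_apply, map_one_sub_weighted, hX]
  have hN0 : N ≠ 0 := by
    obtain ⟨x, hx⟩ := Γ.exists_det_block_ne_zero hO hΓ
    intro h
    exact hx (by rw [← hN, h, map_zero])
  have hK0 : K.det ≠ 0 := by
    intro h
    -- At zero weights the transfer matrix vanishes and the determinant is `1`.
    have h1 := congrArg Matrix.det (hK 0)
    rw [← AlgHom.map_det, h, map_zero] at h1
    have h2 : weighted (Γ.stepPhase O) (0 : E → ℂ) = 0 := by ext; simp [weighted]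
    simp [h2] at h1
  -- The weights found above may be zero on some edges; a point off the zero set of this product has
  -- non-zero weights, a regular value and a non-zero determinant.
  have hprod : N * K.det * ∏ e, MvPolynomial.X e ≠ 0 :=
    mul_ne_zero (mul_ne_zero hN0 hK0)
      (Finset.prod_ne_zero_iff.2 fun e _ => MvPolynomial.X_ne_zero e)
  obtain ⟨x, hx⟩ : ∃ x : E → ℂ, MvPolynomial.eval x (N * K.det * ∏ e, MvPolynomial.X e) ≠ 0 := by
    by_contra! h
    exact hprod (MvPolynomial.funext fun x => by rw [h x, map_zero])
  rw [map_mul, map_mul, map_prod] at hx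
  have hxe : ∀ e, x e ≠ 0 := fun e => by
    have := Finset.prod_ne_zero_iff.1 (right_ne_zero_of_mul hx) e (Finset.mem_univ e)
    rwa [MvPolynomial.eval_X] at this
  have hxK : MvPolynomial.eval x K.det ≠ 0 := right_ne_zero_of_mul (left_ne_zero_of_mul hx)
  have hxN : MvPolynomial.eval x N ≠ 0 := left_ne_zero_of_mul (left_ne_zero_of_mul hx)
  rw [← MvPolynomial.coe_aeval_eq_eval] at hxK hxN
  change MvPolynomial.aeval x K.det ≠ 0 at hxK
  change MvPolynomial.aeval x N ≠ 0 at hxN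
  have hu : (1 - weighted (Γ.stepPhase O) x).det = MvPolynomial.aeval x K.det := by
    rw [AlgHom.map_det, hK]
  have hunit : IsUnit (1 - weighted (Γ.stepPhase O) x).det := by
    rw [hu]
    exact hxK.isUnit
  rw [hN, det_block _ _ _ _ hunit] at hxN
  -- The matrix is `R (1 - K)⁻¹ C` evaluated at `x`, as supplied by `det_block`.
  refine ⟨fun e => Units.mk0 (x e) (hxe e), _, fun i j => ?_, right_ne_zero_of_mul hxN⟩
  refine ⟨_, _, Γ.coe_det_mul_pathSeries O i j, ?_, ?_⟩
  · exact hxK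
  · simp only [Units.val_mk0]
    change _ = MvPolynomial.aeval x _ / MvPolynomial.aeval x K.det
    have hC : (Matrix.of fun e j => (MvPolynomial.C (Γ.endPhase O e j) : MvPolynomial E ℂ)).map
        (MvPolynomial.aeval x : MvPolynomial E ℂ →ₐ[ℂ] ℂ) = Matrix.of (Γ.endPhase O) := by
      ext1 e j
      simp
    rw [← Matrix.map_apply (f := (MvPolynomial.aeval x : MvPolynomial E ℂ →ₐ[ℂ] ℂ)),
      Matrix.map_mul, Matrix.map_mul, map_weighted, hX, ← AlgHom.mapMatrix_apply,
      AlgHom.map_adjugate, hC]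
    change _ = (weighted (Γ.startPhase O) x *
      (((MvPolynomial.aeval x : MvPolynomial E ℂ →ₐ[ℂ] ℂ).mapMatrix K).adjugate *
        Matrix.of (Γ.endPhase O))) i j / _
    rw [hK, ← hu, Matrix.inv_def, Ring.inverse_eq_inv', Matrix.smul_mul, Matrix.mul_smul,
      Matrix.smul_apply, smul_eq_mul, inv_mul_eq_div]
    rfl

theorem not_detVanishes [Finite V] {Γ : PlabicGraph n V E} {O : E → Bool} (hO : Γ.IsPerfect O)
    (hΓ : Γ.colorSwap.PerfectlyOrientable) : ¬ Γ.DetVanishes O := by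
  obtain ⟨w, A, hA, hdet⟩ := exists_isBoundaryMeasurement hO hΓ
  exact fun h => hdet (h ⟨Γ.faceWeight O w, Γ.finprod_faceWeight O w⟩ A ⟨w, rfl, hA⟩)

theorem NonDegenerate.perfectlyOrientable_colorSwap {Γ : PlabicGraph n V E}
    (h : Γ.NonDegenerate) : Γ.colorSwap.PerfectlyOrientable := by
  obtain ⟨O, hO, hdet⟩ := h
  simp only [DetVanishes, not_forall] at hdet
  obtain ⟨Y, A, ⟨w, -, hA⟩, hne⟩ := hdet
  obtain ⟨σ, hσ⟩ := hA.exists_isFlow hne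
  exact hσ.perfectlyOrientable_colorSwap hO

end PlabicGraph

theorem mainTheorem10 {n : ℕ} {V E : Type*} [Fintype V] [Fintype E] (Γ : PlabicGraph n V E) :
    (Γ.NonDegenerate ↔ Γ.PerfectlyOrientable ∧ Γ.colorSwap.PerfectlyOrientable) ∧
    (∀ O : E → Bool, Γ.IsPerfect O → (Γ.NonDegenerate ↔ ¬ Γ.DetVanishes O)) := by
  refine ⟨⟨fun h => ⟨?_, h.perfectlyOrientable_colorSwap⟩, ?_⟩, fun O hO => ⟨fun h => ?_, ?_⟩⟩
  · obtain ⟨O, hO, -⟩ := h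
    exact ⟨O, hO⟩
  · rintro ⟨⟨O, hO⟩, hΓ⟩
    exact ⟨O, hO, PlabicGraph.not_detVanishes hO hΓ⟩
  · exact PlabicGraph.not_detVanishes hO h.perfectlyOrientable_colorSwap
  · exact fun h => ⟨O, hO, h⟩
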